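/- Let $n\ge 1$, let $\gamma:\mathbb R^n\to\mathbb R$ be measurable with $0<\underline\gamma\le\gamma(x)\le\overline\gamma<\infty$ for a.e. $x\in\mathbb R^n$ and some constants $\underline\gamma,\overline\gamma$. For $s\in(0,1)$ put $$\mathcal C_{n,s}=\frac{4^s\,\Gamma(n/2+s)}{\pi^{n/2}\,|\Gamma(-s)|},\qquad \nabla^s u(x,y)=-\frac{\mathcal C_{n,s}^{1/2}}{\sqrt2}\,\frac{u(y)-u(x)}{|y-x|^{n/2+s+1}}\,(y-x),$$ $$\Theta(x,y)=\gamma(x)^{1/2}\gamma(y)^{1/2}\,\mathrm{Id},\qquad B^s_\gamma[u,v]=\int_{\mathbb R^n}\int_{\mathbb R^n}\nabla^s v\cdot(\Theta\cdot\nabla^s u)\,dy\,dx.$$ Let $u,v\in H^1(\mathbb R^n)$ be real-valued, with weak gradients $\nabla u,\nabla v$. Then $\nabla^s v\cdot(\Theta\cdot\nabla^s u)$ is integrable on $\mathbb R^{2n}$ for every $s\in(0,1)$, $\gamma\,\nabla u\cdot\nabla v$ is integrable on $\mathbb R^n$, and $$\lim_{s\to1^-}B^s_\gamma[u,v]=\int_{\mathbb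 R^n}\gamma\,\nabla u\cdot\nabla v\,dx .$$ -/

import Mathlib

open MeasureTheory Filter Topology
open scoped ContDiff

noncomputable section

namespace FracCond

/-- Euclidean space `ℝⁿ`. -/
abbrev Eucl (n : ℕ) : Type := EuclideanSpace ℝ (Fin n)

/-- `G : ℝⁿ → ℝⁿ` is a weak (distributional) gradient of `u : ℝⁿ → ℝ`: for every test function `φ`
and every direction `e`, `∫ u ∂ₑφ = - ∫ φ ⟨G, e⟩`. -/
structure HasWeakGradient {n : ℕ} (u : Eucl n → ℝ) (G : Eucl n → Eucl n) : Prop where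
  locallyIntegrable : LocallyIntegrable u volume
  locallyIntegrable_grad : LocallyIntegrable G volume
  integral_eq : ∀ φ : Eucl n → ℝ, ContDiff ℝ ∞ φ → HasCompactSupport φ → ∀ e : Eucl n,
    ∫ x, u x * fderiv ℝ φ x e = - ∫ x, φ x * inner ℝ (G x) e

/-- The Sobolev space `H¹(ℝⁿ)` of real-valued functions: `u ∈ L²` with a weak gradient in `L²`. -/
def MemH1 {n : ℕ} (u : Eucl n → ℝ) : Prop :=
  MemLp u 2 volume ∧ ∃ G : Eucl n → Eucl n, MemLp G 2 volume ∧ HasWeakGradient u G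

/-- The constant `C_{n,s} = 4^s Γ(n/2 + s) / (π^{n/2} |Γ(-s)|)` of the fractional Laplacian. -/
def fracConst (n : ℕ) (s : ℝ) : ℝ :=
  (4 : ℝ) ^ s * Real.Gamma ((n : ℝ) / 2 + s) /
    (Real.pi ^ ((n : ℝ) / 2) * |Real.Gamma (-s)|)

/-- The fractional gradient
`∇ˢu(x,y) = - (C_{n,s}^{1/2} / √2) (u(y) - u(x)) / |y - x|^{n/2 + s + 1} (y - x)`.
It is linear in `u` and its `L²(ℝ²ⁿ)` norm is controlled by the `Hˢ` norm of `u`; so the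
continuous extension of `∇ˢ` from test functions to `Hˢ(ℝⁿ)` is given by the same formula, for
almost every `(x, y)`. On the (null) diagonal the value is `0`. -/
def fracGradient {n : ℕ} (s : ℝ) (u : Eucl n → ℝ) (x y : Eucl n) : Eucl n :=
  (-(Real.sqrt (fracConst n s) / Real.sqrt 2) *
    ((u y - u x) / ‖y - x‖ ^ ((n : ℝ) / 2 + s + 1))) • (y - x)

/-- The interaction matrix `Θ(x,y) = γ(x)^{1/2} γ(y)^{1/2} Id`, as a linear map of `ℝⁿ`. -/
def interaction {n : ℕ} (γ : Eucl n → ℝ) (x y : Eucl n) : Eucl n →L[ℝ] Eucl n :=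
  (Real.sqrt (γ x) * Real.sqrt (γ y)) • ContinuousLinearMap.id ℝ (Eucl n)

/-- The integrand `∇ˢv · (Θ · ∇ˢu)` of the bilinear form. -/
def bilinIntegrand {n : ℕ} (s : ℝ) (γ u v : Eucl n → ℝ) (x y : Eucl n) : ℝ :=
  inner ℝ (fracGradient s v x y) (interaction γ x y (fracGradient s u x y))

/-- The bilinear form `Bˢ_γ[u,v] = ∫ ∫ ∇ˢv · (Θ · ∇ˢu) dy dx`. -/
def bilin {n : ℕ} (s : ℝ) (γ u v : Eucl n → ℝ) : ℝ :=
  ∫ x, ∫ y, bilinIntegrand s γ u v x y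

end FracCond

end

/-!
# Localization of the weighted fractional bilinear form as `s → 1`
-/

/-! Put `a = √γ` and substitute `y = x + h`. By Fubini the form becomes `∫ K_s(h) g(h) dh`, where
`K_s(h) = (C_{n,s}/2) |h|^{-n-2s}` is radial and `g(h) = ∫ a(x) a(x+h) (u(x+h) - u(x)) (v(x+h) -
v(x)) dx` does not depend on `s` (`integrable_bilinIntegrand`). Two independent facts then give the
limit.

Regularity of `g`: it is bounded, is `O(|h|²)`, and equals `∑ Q_ij h_i h_j + o(|h|²)` with `Q_ij = ∫
γ ∂_i u ∂_j v`. For `u` and `v` this is the first order expansion of translations in `L²`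
(`HasWeakGradient.eLpNorm_remainder_le`). The weight is only measurable, and `a(x+h)` is replaced by
`a(x)` through continuity of translations on `L¹` (`exists_modulus_incrementProduct`).

Concentration of `K_s`: since `C_{n,s}` is asymptotic to `4(1-s)/ω_n`, with `ω_n` the volume of the
unit ball, the mass of `K_s` off any ball around `0` vanishes as `s → 1`, while its second moment on
that ball tends to `n`. By symmetry each diagonal second moment tends to `1` and the mixed ones are
zero, so the limit is the trace of `Q` (`tendsto_integral_fracKernel_mul`), which is the local form.
-/

noncomputable section
namespace FracCond

open scoped ENNReal NNReal

/-! ### Translations on `Lᵖ` -/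

section Translation

variable {n : ℕ} {F : Type*} [NormedAddCommGroup F]

theorem measurePreserving_translate (h : Eucl n) :
    MeasurePreserving (fun x : Eucl n => x + h) volume volume :=
  measurePreserving_add_right volume h

theorem eLpNorm_translate {p : ℝ≥0∞} {f : Eucl n → F} (hf : AEStronglyMeasurable f volume)
    (h : Eucl n) : eLpNorm (fun x => f (x + h)) p volume = eLpNorm f p volume :=
  eLpNorm_comp_measurePreserving hf (measurePreserving_translate h)

theorem memLp_translate {p : ℝ≥0∞} {f : Eucl n → F} (hf : MemLp f p volume) (h : Eucl n) :
    MemLp (fun x => f (x + h)) p volume :=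
  hf.comp_measurePreserving (measurePreserving_translate h)

/-- Translations act continuously on `Lᵖ` for `1 ≤ p < ∞`. -/
theorem tendsto_eLpNorm_translate_sub {p : ℝ≥0∞} [hp1 : Fact (1 ≤ p)] (hp : p ≠ ⊤)
    {f : Eucl n → F} (hf : MemLp f p volume) :
    Tendsto (fun h : Eucl n => eLpNorm (fun x => f (x + h) - f x) p volume) (𝓝 0) (𝓝 0) := by
  let T : Eucl n → C(Eucl n, Eucl n) := fun h => ⟨fun x => x + h, by fun_prop⟩
  have hT : Continuous T :=
    ContinuousMap.continuous_of_continuous_uncurry _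
      (show Continuous fun q : Eucl n × Eucl n => q.2 + q.1 by fun_prop)
  have hTm : ∀ h, MeasurePreserving (T h) volume volume := measurePreserving_translate
  have hc : Continuous fun h => Lp.compMeasurePreserving (T h) (hTm h) (hf.toLp f) :=
    Continuous.compMeasurePreservingLp continuous_const hT hTm hp
  have h1 := (hc.tendsto 0).edist (tendsto_const_nhds (x := hf.toLp f))
  have h0 : Lp.compMeasurePreserving (T 0) (hTm 0) (hf.toLp f) = hf.toLp f := by
    rw [Lp.toLp_compMeasurePreserving]
    congr 1
    ext x
    simp [T]
  rw [h0, edist_self] at h1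
  refine h1.congr fun h => ?_
  rw [Lp.toLp_compMeasurePreserving, Lp.edist_toLp_toLp]
  rfl

end Translation

/-! ### Weak gradients and first order expansion in `L²` -/

section WeakGradient

variable {n : ℕ}

/-- Lebesgue measure on the unit interval. -/
abbrev unitIntervalMeasure : Measure ℝ := volume.restrict (Set.Icc 0 1)

instance : IsProbabilityMeasure unitIntervalMeasure := ⟨by simp⟩

/-- The shear `(t, x) ↦ (t, x + t h)` preserves the product measure, and projecting off a
probability factor preserves the measure too. -/
theorem measurePreserving_segment (h : Eucl n) :
    MeasurePreserving (fun z : ℝ × Eucl n => z.2 + z.1 • h)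
      (unitIntervalMeasure.prod volume) volume := by
  have h1 : MeasurePreserving (fun z : ℝ × Eucl n => (z.1, z.2 + z.1 • h))
      (unitIntervalMeasure.prod volume) (unitIntervalMeasure.prod volume) :=
    (MeasurePreserving.id unitIntervalMeasure).skew_product (g := fun t x => x + t • h)
      (by fun_prop) (Eventually.of_forall fun t => map_add_right_eq_self volume (t • h))
  exact measurePreserving_snd.comp h1

theorem memLp_snd {F : Type*} [NormedAddCommGroup F] {f : Eucl n → F} {p : ℝ≥0∞}
    (hf : MemLp f p volume) :
    MemLp (fun z : ℝ × Eucl n => f z.2) p (unitIntervalMeasure.prod volume) :=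
  hf.comp_measurePreserving measurePreserving_snd

theorem memLp_segment {F : Type*} [NormedAddCommGroup F] {f : Eucl n → F} {p : ℝ≥0∞}
    (hf : MemLp f p volume) (h : Eucl n) :
    MemLp (fun z : ℝ × Eucl n => f (z.2 + z.1 • h)) p (unitIntervalMeasure.prod volume) :=
  hf.comp_measurePreserving (measurePreserving_segment h)

theorem locallyIntegrable_integral_of_memLp {k : ℝ × Eucl n → ℝ}
    (hk : MemLp k 2 (unitIntervalMeasure.prod volume)) :
    LocallyIntegrable (fun x => ∫ t, k (t, x) ∂unitIntervalMeasure) volume := by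
  rw [locallyIntegrable_iff]
  intro K hK
  have : IsFiniteMeasure (volume.restrict K) := ⟨by simpa using hK.measure_lt_top⟩
  have h1 : MemLp k 2 (unitIntervalMeasure.prod (volume.restrict K)) := by
    have := hk.restrict (Set.univ ×ˢ K)
    rwa [← Measure.prod_restrict, Measure.restrict_univ] at this
  exact (h1.integrable (by norm_num)).integral_prod_right

theorem memLp_of_contDiff_hasCompactSupport {φ : Eucl n → ℝ} (hφ : ContDiff ℝ ∞ φ)
    (hc : HasCompactSupport φ) : MemLp φ 2 volume :=
  hφ.continuous.memLp_of_hasCompactSupport hc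

theorem memLp_inner_const {α : Type*} [MeasurableSpace α] {μ : Measure α} {p : ℝ≥0∞}
    {G : α → Eucl n} (hG : MemLp G p μ) (h : Eucl n) :
    MemLp (fun x => inner ℝ (G x) h) p μ :=
  hG.inner_const h

/-- A function with a weak gradient in `L²` satisfies the fundamental theorem of calculus along
almost every segment. -/
theorem HasWeakGradient.ae_sub_eq_integral {u : Eucl n → ℝ} {G : Eucl n → Eucl n}
    (hu : MemLp u 2 volume) (hG : MemLp G 2 volume) (hw : HasWeakGradient u G) (h : Eucl n) :
    ∀ᵐ x, u (x + h) - u x = ∫ t, inner ℝ (G (x + t • h)) h ∂unitIntervalMeasure := by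
  have hk := memLp_inner_const (memLp_segment hG h) h
  have hu' := memLp_translate hu h
  refine ae_eq_of_integral_contDiff_smul_eq
    ((hu'.sub hu).locallyIntegrable (by norm_num)) (locallyIntegrable_integral_of_memLp hk) ?_
  intro φ hφ hφc
  simp only [smul_eq_mul]
  have hφ2 := memLp_of_contDiff_hasCompactSupport hφ hφc
  have hdc : HasCompactSupport fun x => fderiv ℝ φ x h :=
    (hφc.fderiv ℝ).comp_left (g := fun L : Eucl n →L[ℝ] ℝ => L h) rfl
  have hdcont : Continuous fun x => fderiv ℝ φ x h :=
    (hφ.continuous_fderiv (by simp)).clm_apply continuous_const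
  have hd2 : MemLp (fun x => fderiv ℝ φ x h) 2 volume := hdcont.memLp_of_hasCompactSupport hdc
  have hI1 : Integrable (fun z : ℝ × Eucl n => φ z.2 * inner ℝ (G (z.2 + z.1 • h)) h)
      (unitIntervalMeasure.prod volume) := (memLp_snd hφ2).integrable_mul hk
  have hI2 : Integrable (fun z : ℝ × Eucl n => u z.2 * fderiv ℝ φ (z.2 + z.1 • (-h)) h)
      (unitIntervalMeasure.prod volume) := (memLp_snd hu).integrable_mul (memLp_segment hd2 (-h))
  -- Weak gradient tested against the translate of `φ`, then a change of variable.
  have key : ∀ t : ℝ, ∫ x, u x * fderiv ℝ φ (x + t • (-h)) h =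
      - ∫ x, φ x * inner ℝ (G (x + t • h)) h := by
    intro t
    have h1 := hw.integral_eq (fun x => φ (x + t • (-h))) (hφ.comp (by fun_prop))
      (hφc.comp_homeomorph (Homeomorph.addRight (t • (-h)))) h
    simp only [fderiv_comp_add_right] at h1
    rw [h1, ← integral_add_right_eq_self _ (t • h)]
    simp
  have ftc : ∀ x, φ (x - h) - φ x = - ∫ t, fderiv ℝ φ (x + t • (-h)) h ∂unitIntervalMeasure := by
    intro x
    have hder : ∀ t ∈ Set.uIcc (0 : ℝ) 1, HasDerivAt (fun t : ℝ => φ (x + t • (-h)))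
        (fderiv ℝ φ (x + t • (-h)) (-h)) t := by
      intro t _
      have h2 : HasDerivAt (fun t : ℝ => x + t • (-h)) (-h) t := by
        simpa using ((hasDerivAt_id t).smul_const (-h)).const_add x
      exact ((hφ.differentiable (by simp)) _).hasFDerivAt.comp_hasDerivAt t h2
    have h3 := intervalIntegral.integral_eq_sub_of_hasDerivAt hder (by
      apply Continuous.intervalIntegrable
      simp only [map_neg]
      exact (hdcont.comp (by fun_prop : Continuous fun t : ℝ => x + t • (-h))).neg)
    rw [intervalIntegral.integral_of_le zero_le_one, ← integral_Icc_eq_integral_Ioc] at h3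
    simp only [map_neg, integral_neg, one_smul, zero_smul, add_zero] at h3
    rw [h3, sub_eq_add_neg x h]
  -- Discrete integration by parts: the difference moves onto the smooth `φ`, where the classical
  -- `ftc` applies.
  have hL : ∫ x, φ x * (u (x + h) - u x) = ∫ x, u x * (φ (x - h) - φ x) := by
    have i1 : Integrable fun x => φ x * u (x + h) := hφ2.integrable_mul hu'
    have i2 : Integrable fun x => φ x * u x := hφ2.integrable_mul hu
    have i3 : Integrable fun x => u x * φ (x - h) := by
      simp only [sub_eq_add_neg]
      exact hu.integrable_mul (memLp_translate hφ2 (-h))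
    have i4 : Integrable fun x => u x * φ x := hu.integrable_mul hφ2
    simp only [mul_sub]
    rw [integral_sub i1 i2, integral_sub i3 i4,
      ← integral_add_right_eq_self (fun x => u x * φ (x - h)) h]
    simp [mul_comm]
  calc ∫ x, φ x * (u (x + h) - u x)
      = ∫ x, u x * (φ (x - h) - φ x) := hL
    _ = - ∫ x, ∫ t, u x * fderiv ℝ φ (x + t • (-h)) h ∂unitIntervalMeasure := by
        rw [← integral_neg]
        congr 1 with x
        rw [ftc, integral_const_mul, mul_neg]
    _ = - ∫ t, ∫ x, u x * fderiv ℝ φ (x + t • (-h)) h ∂volume ∂unitIntervalMeasure := by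
        rw [integral_integral_swap (f := fun t x => u x * fderiv ℝ φ (x + t • (-h)) h) hI2]
    _ = ∫ t, ∫ x, φ x * inner ℝ (G (x + t • h)) h ∂volume ∂unitIntervalMeasure := by
        simp only [key, integral_neg, neg_neg]
    _ = ∫ x, ∫ t, φ x * inner ℝ (G (x + t • h)) h ∂unitIntervalMeasure :=
        integral_integral_swap hI1
    _ = ∫ x, φ x * ∫ t, inner ℝ (G (x + t • h)) h ∂unitIntervalMeasure := by
        simp only [integral_const_mul]

/-- Weak gradients are unique up to null sets. -/
theorem HasWeakGradient.ae_eq {u : Eucl n → ℝ} {G G' : Eucl n → Eucl n}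
    (h : HasWeakGradient u G) (h' : HasWeakGradient u G') : G =ᵐ[volume] G' := by
  refine ae_eq_of_integral_contDiff_smul_eq h.locallyIntegrable_grad h'.locallyIntegrable_grad ?_
  intro φ hφ hφc
  have hint : ∀ {K : Eucl n → Eucl n}, LocallyIntegrable K volume →
      Integrable (fun x => φ x • K x) volume := fun hK =>
    hK.integrable_smul_left_of_hasCompactSupport hφ.continuous hφc
  refine ext_inner_right ℝ fun e => ?_
  rw [real_inner_comm, real_inner_comm e, ← integral_inner (hint h.locallyIntegrable_grad),
    ← integral_inner (hint h'.locallyIntegrable_grad)]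
  simp only [inner_smul_right]
  have := (h.integral_eq φ hφ hφc e).symm.trans (h'.integral_eq φ hφ hφc e)
  simpa [real_inner_comm] using this

/-- The modulus of continuity in `L²` of a field along segments. -/
def segmentModulus (G : Eucl n → Eucl n) (h : Eucl n) : ℝ≥0∞ :=
  ⨆ t ∈ Set.Icc (0 : ℝ) 1, eLpNorm (fun x => G (x + t • h) - G x) 2 volume

/-- Balls centred at `0` are star-shaped, so the radius that works for `h` works for every `t • h`
at once. -/
theorem tendsto_segmentModulus {G : Eucl n → Eucl n} (hG : MemLp G 2 volume) :
    Tendsto (segmentModulus G) (𝓝 0) (𝓝 0) := by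
  have : Fact ((1 : ℝ≥0∞) ≤ 2) := ⟨by norm_num⟩
  have h := tendsto_eLpNorm_translate_sub (p := 2) (by norm_num) hG
  rw [ENNReal.tendsto_nhds_zero] at h ⊢
  intro ε hε
  obtain ⟨δ, hδ, hb⟩ := Metric.eventually_nhds_iff_ball.1 (h ε hε)
  refine Metric.eventually_nhds_iff_ball.2 ⟨δ, hδ, fun y hy => ?_⟩
  refine iSup₂_le fun t ht => hb _ ?_
  rw [mem_ball_zero_iff] at hy ⊢
  rw [norm_smul, Real.norm_eq_abs, abs_of_nonneg ht.1]
  exact (mul_le_of_le_one_left (norm_nonneg _) ht.2).trans_lt hy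

theorem segmentModulus_le {G : Eucl n → Eucl n} (hG : MemLp G 2 volume) (h : Eucl n) :
    segmentModulus G h ≤ 2 * eLpNorm G 2 volume := by
  refine iSup₂_le fun t _ => ?_
  refine (eLpNorm_sub_le (memLp_translate hG _).1 hG.1 (by norm_num)).trans ?_
  rw [eLpNorm_translate hG.1, two_mul]

theorem eLpNorm_two_sq {α F : Type*} [MeasurableSpace α] [NormedAddCommGroup F] (f : α → F)
    (μ : Measure α) : eLpNorm f 2 μ ^ 2 = ∫⁻ x, ‖f x‖ₑ ^ 2 ∂μ := by
  have := eLpNorm_nnreal_pow_eq_lintegral (f := f) (μ := μ) (p := 2) (by norm_num)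
  simpa using this

theorem enorm_integral_sq_le {α : Type*} [MeasurableSpace α] {μ : Measure α}
    [IsProbabilityMeasure μ] {f : α → ℝ} (hf : AEStronglyMeasurable f μ) :
    ‖∫ t, f t ∂μ‖ₑ ^ 2 ≤ ∫⁻ t, ‖f t‖ₑ ^ 2 ∂μ := by
  rw [← eLpNorm_two_sq]
  gcongr
  refine (enorm_integral_le_lintegral_enorm f).trans ?_
  rw [← eLpNorm_one_eq_lintegral_enorm]
  exact eLpNorm_le_eLpNorm_of_exponent_le (by norm_num) hf

/-- First order expansion of translations in `L²`. -/
theorem HasWeakGradient.eLpNorm_remainder_le {u : Eucl n → ℝ} {G : Eucl n → Eucl n}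
    (hu : MemLp u 2 volume) (hG : MemLp G 2 volume) (hw : HasWeakGradient u G) (h : Eucl n) :
    eLpNorm (fun x => u (x + h) - u x - inner ℝ (G x) h) 2 volume ≤
      ‖h‖ₑ * segmentModulus G h := by
  set k : ℝ × Eucl n → ℝ := fun z => inner ℝ (G (z.2 + z.1 • h) - G z.2) h with hkdef
  have hk : MemLp k 2 (unitIntervalMeasure.prod volume) :=
    memLp_inner_const ((memLp_segment hG h).sub (memLp_snd hG)) h
  have hk1 := memLp_inner_const (memLp_segment hG h) h
  have hsec : ∀ᵐ x : Eucl n, Integrable (fun t => inner ℝ (G (x + t • h)) h)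
      unitIntervalMeasure := by
    have hsq : Integrable (fun z : ℝ × Eucl n => (inner ℝ (G (z.2 + z.1 • h)) h : ℝ) ^ 2)
      (unitIntervalMeasure.prod volume) := hk1.integrable_sq
    -- Almost every section in `t` is `L²` on a probability space, hence integrable; this is needed
    -- to split the integral of the difference below.
    filter_upwards [hsq.prod_left_ae, hk1.1.prodMk_right] with x hx hx1
    exact ((memLp_two_iff_integrable_sq hx1).2 hx).integrable (by norm_num)
  have hae : ∀ᵐ x, u (x + h) - u x - inner ℝ (G x) h = ∫ t, k (t, x) ∂unitIntervalMeasure := by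
    filter_upwards [hw.ae_sub_eq_integral hu hG h, hsec] with x hx hs
    simp only [hkdef, inner_sub_left]
    rw [hx, integral_sub hs (integrable_const _)]
    simp
  rw [← ENNReal.pow_le_pow_left_iff two_ne_zero, eLpNorm_two_sq]
  calc ∫⁻ x, ‖u (x + h) - u x - inner ℝ (G x) h‖ₑ ^ 2
      = ∫⁻ x, ‖∫ t, k (t, x) ∂unitIntervalMeasure‖ₑ ^ 2 :=
        lintegral_congr_ae (hae.mono fun x hx => by simp only [hx])
    _ ≤ ∫⁻ x, ∫⁻ t, ‖k (t, x)‖ₑ ^ 2 ∂unitIntervalMeasure :=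
        lintegral_mono_ae (hk.1.prodMk_right.mono fun x hx => enorm_integral_sq_le hx)
    _ = ∫⁻ t, ∫⁻ x, ‖k (t, x)‖ₑ ^ 2 ∂volume ∂unitIntervalMeasure :=
        (lintegral_lintegral_swap (f := fun t x => ‖k (t, x)‖ₑ ^ 2)
          (hk.1.enorm.pow_const 2)).symm
    _ ≤ ∫⁻ t, (‖h‖ₑ * segmentModulus G h) ^ 2 ∂unitIntervalMeasure := by
        refine setLIntegral_mono_ae' measurableSet_Icc (Eventually.of_forall fun t ht => ?_)
        rw [← eLpNorm_two_sq]
        gcongr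
        calc eLpNorm (fun x => k (t, x)) 2 volume
            ≤ ‖h‖ₑ * eLpNorm (fun x => G (x + t • h) - G x) 2 volume := by
              have : eLpNorm (fun x => k (t, x)) 2 volume ≤
                  eLpNorm (fun x => ‖h‖ • (G (x + t • h) - G x)) 2 volume := by
                refine eLpNorm_mono fun x => ?_
                rw [norm_smul, norm_norm, mul_comm]
                exact norm_inner_le_norm _ _
              refine this.trans_eq ?_
              rw [show (fun x => ‖h‖ • (G (x + t • h) - G x)) =
                ‖h‖ • (fun x => G (x + t • h) - G x) from rfl, eLpNorm_const_smul]
              simp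
          _ ≤ ‖h‖ₑ * segmentModulus G h := by
              gcongr
              exact le_iSup₂ (f := fun t (_ : t ∈ Set.Icc (0 : ℝ) 1) =>
                eLpNorm (fun x => G (x + t • h) - G x) 2 volume) t ht
    _ = (‖h‖ₑ * segmentModulus G h) ^ 2 := by simp

theorem eLpNorm_inner_const_le {G : Eucl n → Eucl n} (h : Eucl n) :
    eLpNorm (fun x => (inner ℝ (G x) h : ℝ)) 2 volume ≤ ‖h‖ₑ * eLpNorm G 2 volume := by
  have : eLpNorm (fun x => (inner ℝ (G x) h : ℝ)) 2 volume ≤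
      eLpNorm (‖h‖ • G) 2 volume := by
    refine eLpNorm_mono fun x => ?_
    rw [Pi.smul_apply, norm_smul, norm_norm, mul_comm]
    exact norm_inner_le_norm _ _
  refine this.trans_eq ?_
  rw [eLpNorm_const_smul]
  simp

/-- The constant `3` is `2` from the remainder, via `segmentModulus_le`, plus `1` from the linear
term. It is not sharp; only the factor `‖h‖` matters. -/
theorem HasWeakGradient.eLpNorm_translate_sub_le {u : Eucl n → ℝ} {G : Eucl n → Eucl n}
    (hu : MemLp u 2 volume) (hG : MemLp G 2 volume) (hw : HasWeakGradient u G) (h : Eucl n) :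
    eLpNorm (fun x => u (x + h) - u x) 2 volume ≤ ‖h‖ₑ * (3 * eLpNorm G 2 volume) := by
  have h1 : (fun x => u (x + h) - u x) = (fun x => u (x + h) - u x - inner ℝ (G x) h) +
      fun x => inner ℝ (G x) h := by
    ext x; simp
  rw [h1]
  refine (eLpNorm_add_le (((memLp_translate hu h).sub hu).sub (memLp_inner_const hG h)).1
    (memLp_inner_const hG h).1 (by norm_num)).trans ?_
  have h2 := (hw.eLpNorm_remainder_le hu hG h).trans
    (mul_le_mul_right (segmentModulus_le hG h) ‖h‖ₑ)
  refine (add_le_add h2 (eLpNorm_inner_const_le h)).trans_eq ?_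
  ring

end WeakGradient

/-! ### Products of increments in `L¹` -/

section Increments

variable {n : ℕ}

theorem eLpNorm_one_le_mul {α E E' : Type*} [MeasurableSpace α] {μ : Measure α}
    [NormedAddCommGroup E] [NormedAddCommGroup E'] {F : α → ℝ} {f : α → E} {g : α → E'} (c : ℝ≥0)
    (hf : AEStronglyMeasurable f μ) (hg : AEStronglyMeasurable g μ)
    (hb : ∀ x, ‖F x‖ ≤ c * ‖f x‖ * ‖g x‖) :
    eLpNorm F 1 μ ≤ c * eLpNorm f 2 μ * eLpNorm g 2 μ := by
  have h1 : eLpNorm F 1 μ ≤ eLpNorm (fun x => (c : ℝ) * ‖f x‖ * ‖g x‖) 1 μ :=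
    eLpNorm_mono fun x => (hb x).trans (le_abs_self _)
  refine h1.trans (eLpNorm_le_eLpNorm_mul_eLpNorm'_of_norm hf hg
    (fun p q => (c : ℝ) * ‖p‖ * ‖q‖) c (Eventually.of_forall fun x => ?_))
  rw [Real.norm_of_nonneg (by positivity)]

/-- The weighted product of the increments of `u` and `v` in the direction `h`. -/
def incrementProduct (a u v : Eucl n → ℝ) (h x : Eucl n) : ℝ :=
  a x * a (x + h) * ((u (x + h) - u x) * (v (x + h) - v x))

theorem eLpNorm_incrementProduct_le {a u v : Eucl n → ℝ} {M : ℝ≥0} (hM : ∀ x, |a x| ≤ M)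
    (hu : MemLp u 2 volume) (hv : MemLp v 2 volume) (h : Eucl n) :
    eLpNorm (incrementProduct a u v h) 1 volume ≤ (M ^ 2 : ℝ≥0) *
      eLpNorm (fun x => u (x + h) - u x) 2 volume *
      eLpNorm (fun x => v (x + h) - v x) 2 volume := by
  refine eLpNorm_one_le_mul _ ((memLp_translate hu h).sub hu).1 ((memLp_translate hv h).sub hv).1
    fun x => ?_
  rw [incrementProduct, norm_mul, norm_mul, norm_mul, ← mul_assoc]
  gcongr
  rw [NNReal.coe_pow, sq]
  exact mul_le_mul (hM _) (hM _) (abs_nonneg _) M.2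

theorem eLpNorm_translate_sub_le_two_mul {u : Eucl n → ℝ} (hu : MemLp u 2 volume) (h : Eucl n) :
    eLpNorm (fun x => u (x + h) - u x) 2 volume ≤ 2 * eLpNorm u 2 volume := by
  refine (eLpNorm_sub_le (memLp_translate hu h).1 hu.1 (by norm_num)).trans ?_
  rw [eLpNorm_translate hu.1, two_mul]

theorem memLp_bounded_mul {a f : Eucl n → ℝ} {M : ℝ≥0} (ha : Measurable a)
    (hM : ∀ x, |a x| ≤ M) {p : ℝ≥0∞} (hf : MemLp f p volume) :
    MemLp (fun x => a x * f x) p volume :=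
  hf.of_le_mul (c := M) (ha.aestronglyMeasurable.mul hf.1) (Eventually.of_forall fun x => by
    rw [norm_mul]
    exact mul_le_mul_of_nonneg_right (hM x) (norm_nonneg _))

/-- The weight `a` need not be continuous, nor is it in `L¹`. The translation is therefore
transferred to `a f` and `a² f`, which are in `L¹`. -/
theorem tendsto_eLpNorm_weight {a f : Eucl n → ℝ} {M : ℝ≥0} (ha : Measurable a)
    (hM : ∀ x, |a x| ≤ M) (hf : MemLp f 1 volume) :
    Tendsto (fun h => eLpNorm (fun x => (a x * a (x + h) - a x ^ 2) * f x) 1 volume)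
      (𝓝 0) (𝓝 0) := by
  have : Fact ((1 : ℝ≥0∞) ≤ 1) := ⟨le_rfl⟩
  set F : Eucl n → ℝ := fun x => a x * f x with hF
  have hF1 : MemLp F 1 volume := memLp_bounded_mul ha hM hf
  set F' : Eucl n → ℝ := fun x => a x * F x with hF'
  have hF2 : MemLp F' 1 volume := memLp_bounded_mul ha hM hF1
  have t1 := tendsto_eLpNorm_translate_sub (p := 1) (by norm_num) hF1
  have t2 := tendsto_eLpNorm_translate_sub (p := 1) (by norm_num) hF2
  have t3 : Tendsto (fun h => (M : ℝ≥0∞) * eLpNorm (fun x => F (x + h) - F x) 1 volume +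
      eLpNorm (fun x => F' (x + h) - F' x) 1 volume) (𝓝 0) (𝓝 0) := by
    simpa using (ENNReal.Tendsto.const_mul t1 (Or.inr ENNReal.coe_ne_top)).add t2
  refine tendsto_of_tendsto_of_tendsto_of_le_of_le tendsto_const_nhds t3 (fun _ => zero_le)
    fun h => ?_
  have d1 := (memLp_translate hF1 h).sub hF1
  have d2 := (memLp_translate hF2 h).sub hF2
  have m1 : AEStronglyMeasurable (fun x => a (x + h) * (F (x + h) - F x)) volume :=
    (ha.comp (measurable_add_const h)).aestronglyMeasurable.mul d1.1
  have e : (fun x => (a x * a (x + h) - a x ^ 2) * f x) =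
      (fun x => F' (x + h) - F' x) - fun x => a (x + h) * (F (x + h) - F x) := by
    ext x
    simp only [hF', hF, Pi.sub_apply]
    ring
  rw [e, add_comm]
  refine (eLpNorm_sub_le d2.1 m1 le_rfl).trans (add_le_add le_rfl ?_)
  have : eLpNorm (fun x => a (x + h) * (F (x + h) - F x)) 1 volume ≤
      eLpNorm ((M : ℝ) • fun x => F (x + h) - F x) 1 volume := by
    refine eLpNorm_mono fun x => ?_
    rw [norm_mul, Pi.smul_apply, norm_smul, Real.norm_of_nonneg M.coe_nonneg]
    exact mul_le_mul_of_nonneg_right (hM _) (norm_nonneg _)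
  refine this.trans_eq ?_
  rw [eLpNorm_const_smul]
  simp

/-- Second order expansion in `L¹` of the weighted product of increments. -/
theorem exists_modulus_incrementProduct {a u v : Eucl n → ℝ} {G H : Eucl n → Eucl n} {M : ℝ≥0}
    (ha : Measurable a) (hM : ∀ x, |a x| ≤ M)
    (hu : MemLp u 2 volume) (hv : MemLp v 2 volume)
    (hG : MemLp G 2 volume) (hH : MemLp H 2 volume)
    (hwu : HasWeakGradient u G) (hwv : HasWeakGradient v H) :
    ∃ η : Eucl n → ℝ≥0∞, Tendsto η (𝓝 0) (𝓝 0) ∧ ∀ h,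
      eLpNorm (fun x => incrementProduct a u v h x -
        a x ^ 2 * (inner ℝ (G x) h * inner ℝ (H x) h)) 1 volume ≤ ‖h‖ₑ ^ 2 * η h := by
  have hGH : MemLp (fun x => ‖G x‖ * ‖H x‖) 1 volume :=
    memLp_one_iff_integrable.2 (hG.norm.integrable_mul hH.norm)
  refine ⟨fun h => (M ^ 2 : ℝ≥0) * (segmentModulus G h * (3 * eLpNorm H 2 volume)) +
    (M ^ 2 : ℝ≥0) * (eLpNorm G 2 volume * segmentModulus H h) +
    eLpNorm (fun x => (a x * a (x + h) - a x ^ 2) * (‖G x‖ * ‖H x‖)) 1 volume, ?_, fun h => ?_⟩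
  · have t1 := ENNReal.Tendsto.const_mul (a := ((M ^ 2 : ℝ≥0) : ℝ≥0∞))
      (ENNReal.Tendsto.mul_const (b := 3 * eLpNorm H 2 volume) (tendsto_segmentModulus hG)
        (Or.inr (ENNReal.mul_ne_top (by norm_num) hH.2.ne))) (Or.inr ENNReal.coe_ne_top)
    have t2 := ENNReal.Tendsto.const_mul (a := ((M ^ 2 : ℝ≥0) : ℝ≥0∞))
      (ENNReal.Tendsto.const_mul (a := eLpNorm G 2 volume) (tendsto_segmentModulus hH)
        (Or.inr hG.2.ne)) (Or.inr ENNReal.coe_ne_top)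
    simpa using (t1.add t2).add (tendsto_eLpNorm_weight ha hM hGH)
  · set du : Eucl n → ℝ := fun x => u (x + h) - u x with hdu
    set dv : Eucl n → ℝ := fun x => v (x + h) - v x with hdv
    set gu : Eucl n → ℝ := fun x => inner ℝ (G x) h with hgu
    set gv : Eucl n → ℝ := fun x => inner ℝ (H x) h with hgv
    have mdu : MemLp du 2 volume := (memLp_translate hu h).sub hu
    have mdv : MemLp dv 2 volume := (memLp_translate hv h).sub hv
    have mgu : MemLp gu 2 volume := memLp_inner_const hG h
    have mgv : MemLp gv 2 volume := memLp_inner_const hH h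
    have mah : Measurable fun x => a (x + h) := ha.comp (measurable_add_const h)
    set f1 : Eucl n → ℝ := fun x => a x * a (x + h) * ((du x - gu x) * dv x) with hf1
    set f2 : Eucl n → ℝ := fun x => a x * a (x + h) * (gu x * (dv x - gv x)) with hf2
    set f3 : Eucl n → ℝ := fun x => (a x * a (x + h) - a x ^ 2) * (gu x * gv x) with hf3
    have m1 : AEStronglyMeasurable f1 volume :=
      (ha.mul mah).aestronglyMeasurable.mul ((mdu.sub mgu).1.mul mdv.1)
    have m2 : AEStronglyMeasurable f2 volume :=
      (ha.mul mah).aestronglyMeasurable.mul (mgu.1.mul (mdv.sub mgv).1)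
    have m3 : AEStronglyMeasurable f3 volume :=
      ((ha.mul mah).sub (ha.pow_const 2)).aestronglyMeasurable.mul (mgu.1.mul mgv.1)
    -- Telescoping: replace the increment of `u`, then that of `v`, then the weight; each term
    -- carries one small factor.
    have e : (fun x => incrementProduct a u v h x - a x ^ 2 * (gu x * gv x)) = f1 + f2 + f3 := by
      ext x
      simp only [incrementProduct, hf1, hf2, hf3, hdu, hdv, Pi.add_apply]
      ring
    have haa : ∀ x, ‖a x * a (x + h)‖ ≤ ((M ^ 2 : ℝ≥0) : ℝ) := fun x => by
      rw [norm_mul, NNReal.coe_pow, sq]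
      exact mul_le_mul (hM _) (hM _) (abs_nonneg _) M.2
    have b1 : eLpNorm f1 1 volume ≤
        ‖h‖ₑ ^ 2 * ((M ^ 2 : ℝ≥0) * (segmentModulus G h * (3 * eLpNorm H 2 volume))) := by
      calc eLpNorm f1 1 volume ≤ (M ^ 2 : ℝ≥0) * eLpNorm (fun x => du x - gu x) 2 volume *
            eLpNorm dv 2 volume := by
            refine eLpNorm_one_le_mul _ (mdu.sub mgu).1 mdv.1 fun x => ?_
            rw [hf1, norm_mul, norm_mul _ (dv x), ← mul_assoc]
            gcongr
            exact haa x
        _ ≤ (M ^ 2 : ℝ≥0) * (‖h‖ₑ * segmentModulus G h) *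
            (‖h‖ₑ * (3 * eLpNorm H 2 volume)) := by
            gcongr
            · exact hwu.eLpNorm_remainder_le hu hG h
            · exact hwv.eLpNorm_translate_sub_le hv hH h
        _ = _ := by ring
    have b2 : eLpNorm f2 1 volume ≤
        ‖h‖ₑ ^ 2 * ((M ^ 2 : ℝ≥0) * (eLpNorm G 2 volume * segmentModulus H h)) := by
      calc eLpNorm f2 1 volume ≤ (M ^ 2 : ℝ≥0) * eLpNorm gu 2 volume *
            eLpNorm (fun x => dv x - gv x) 2 volume := by
            refine eLpNorm_one_le_mul _ mgu.1 (mdv.sub mgv).1 fun x => ?_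
            rw [hf2, norm_mul, norm_mul (gu x), ← mul_assoc]
            gcongr
            exact haa x
        _ ≤ (M ^ 2 : ℝ≥0) * (‖h‖ₑ * eLpNorm G 2 volume) * (‖h‖ₑ * segmentModulus H h) := by
            gcongr
            · exact eLpNorm_inner_const_le h
            · exact hwv.eLpNorm_remainder_le hv hH h
        _ = _ := by ring
    -- Cauchy–Schwarz in `ℝⁿ` extracts `‖h‖²` and leaves the fixed `L¹` density `‖G‖ ‖H‖`, as
    -- `tendsto_eLpNorm_weight` requires.
    have b3 : eLpNorm f3 1 volume ≤ ‖h‖ₑ ^ 2 *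
        eLpNorm (fun x => (a x * a (x + h) - a x ^ 2) * (‖G x‖ * ‖H x‖)) 1 volume := by
      have : eLpNorm f3 1 volume ≤ eLpNorm ((‖h‖ ^ 2) •
          fun x => (a x * a (x + h) - a x ^ 2) * (‖G x‖ * ‖H x‖)) 1 volume := by
        refine eLpNorm_mono fun x => ?_
        rw [hf3, Pi.smul_apply, norm_smul, norm_mul, norm_mul, norm_mul, norm_mul (‖G x‖),
          norm_norm, norm_norm, Real.norm_of_nonneg (by positivity : (0 : ℝ) ≤ ‖h‖ ^ 2)]
        have i1 : ‖gu x‖ ≤ ‖G x‖ * ‖h‖ := norm_inner_le_norm _ _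
        have i2 : ‖gv x‖ ≤ ‖H x‖ * ‖h‖ := norm_inner_le_norm _ _
        calc ‖a x * a (x + h) - a x ^ 2‖ * (‖gu x‖ * ‖gv x‖)
            ≤ ‖a x * a (x + h) - a x ^ 2‖ * ((‖G x‖ * ‖h‖) * (‖H x‖ * ‖h‖)) := by gcongr
          _ = _ := by ring
      refine this.trans_eq ?_
      rw [eLpNorm_const_smul]
      simp
    rw [e, mul_add, mul_add]
    refine (eLpNorm_add_le (m1.add m2) m3 le_rfl).trans (add_le_add ?_ b3)
    exact (eLpNorm_add_le m1 m2 le_rfl).trans (add_le_add b1 b2)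

end Increments

/-! ### The radial kernel: normalization and second moments -/

section Kernel

variable {n : ℕ}

theorem fracConst_nonneg {s : ℝ} (hs : 0 < s) : 0 ≤ fracConst n s := by
  have : 0 < Real.Gamma ((n : ℝ) / 2 + s) := Real.Gamma_pos_of_pos (by positivity)
  unfold fracConst
  positivity

/-- Applying `Γ(z+1) = z Γ(z)` twice turns the pole of `Γ(-s)` at `s = 1` into an explicit factor `1
- s`; the cofactor is continuous there. -/
theorem fracConst_eq {s : ℝ} (h0 : 0 < s) (h1 : s < 1) :
    fracConst n s = (1 - s) * (s * (4 : ℝ) ^ s * Real.Gamma ((n : ℝ) / 2 + s) /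
      (Real.pi ^ ((n : ℝ) / 2) * Real.Gamma (2 - s))) := by
  have e1 : Real.Gamma (1 - s) = -s * Real.Gamma (-s) := by
    rw [← Real.Gamma_add_one (by linarith)]; congr 1; ring
  have e2 : Real.Gamma (2 - s) = (1 - s) * Real.Gamma (1 - s) := by
    rw [← Real.Gamma_add_one (by linarith)]; congr 1; ring
  have p : 0 < Real.Gamma (2 - s) := Real.Gamma_pos_of_pos (by linarith)
  have hs : 0 < 1 - s := by linarith
  have e3 : |Real.Gamma (-s)| = Real.Gamma (2 - s) / ((1 - s) * s) := by
    have : Real.Gamma (-s) = -(Real.Gamma (2 - s) / ((1 - s) * s)) := by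
      rw [e2, e1]; field_simp
    rw [this, abs_neg, abs_of_pos (by positivity)]
  have hpi : 0 < Real.pi ^ ((n : ℝ) / 2) := Real.rpow_pos_of_pos Real.pi_pos _
  rw [fracConst, e3]
  field_simp

/-- The volume of the unit ball. -/
abbrev unitBallVolume (n : ℕ) : ℝ := (volume : Measure (Eucl n)).real (Metric.ball 0 1)

theorem unitBallVolume_eq (hn : 1 ≤ n) :
    unitBallVolume n = Real.pi ^ ((n : ℝ) / 2) / Real.Gamma ((n : ℝ) / 2 + 1) := by
  have : Nonempty (Fin n) := ⟨⟨0, hn⟩⟩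
  have p : 0 < Real.Gamma ((n : ℝ) / 2 + 1) := Real.Gamma_pos_of_pos (by positivity)
  rw [unitBallVolume, Measure.real, EuclideanSpace.volume_ball]
  simp only [ENNReal.ofReal_one, one_pow, one_mul, Fintype.card_fin]
  rw [ENNReal.toReal_ofReal (by positivity), Real.sqrt_eq_rpow, ← Real.rpow_natCast,
    ← Real.rpow_mul Real.pi_pos.le]
  congr 2
  ring

theorem tendsto_fracConst_div (hn : 1 ≤ n) :
    Tendsto (fun s => fracConst n s / (1 - s)) (𝓝[<] 1) (𝓝 (4 / unitBallVolume n)) := by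
  have hpi : 0 < Real.pi ^ ((n : ℝ) / 2) := Real.rpow_pos_of_pos Real.pi_pos _
  have hG : 0 < Real.Gamma ((n : ℝ) / 2 + 1) := Real.Gamma_pos_of_pos (by positivity)
  have hcont : ∀ x : ℝ, 0 < x → ContinuousAt Real.Gamma x := fun x hx =>
    (Real.differentiableAt_Gamma fun m => by
      have : (0 : ℝ) ≤ m := m.cast_nonneg
      linarith).continuousAt
  have c : ContinuousAt (fun s : ℝ => s * (4 : ℝ) ^ s * Real.Gamma ((n : ℝ) / 2 + s) /
      (Real.pi ^ ((n : ℝ) / 2) * Real.Gamma (2 - s))) 1 := by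
    refine ContinuousAt.div ?_ ?_ ?_
    · refine (continuousAt_id.mul (Real.continuousAt_const_rpow (by norm_num))).mul ?_
      exact ContinuousAt.comp (f := fun s : ℝ => (n : ℝ) / 2 + s) (hcont _ (by positivity))
        (by fun_prop)
    · refine continuousAt_const.mul ?_
      exact ContinuousAt.comp (f := fun s : ℝ => 2 - s) (hcont _ (by norm_num)) (by fun_prop)
    · norm_num [hpi.ne']
  have t := c.tendsto.mono_left (nhdsWithin_le_nhds (s := Set.Iio 1))
  have e : (1 * (4 : ℝ) ^ (1 : ℝ) * Real.Gamma ((n : ℝ) / 2 + 1) /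
      (Real.pi ^ ((n : ℝ) / 2) * Real.Gamma (2 - 1))) = 4 / unitBallVolume n := by
    rw [unitBallVolume_eq hn]
    norm_num
    field_simp
  rw [e] at t
  refine t.congr' ?_
  filter_upwards [Ioo_mem_nhdsLT (zero_lt_one' ℝ)] with s hs
  rw [fracConst_eq hs.1 hs.2, mul_div_cancel_left₀]
  linarith [hs.2]

/-- The radial kernel of the bilinear form. -/
def fracKernel (n : ℕ) (s : ℝ) (h : Eucl n) : ℝ :=
  fracConst n s / 2 * ‖h‖ ^ (-((n : ℝ) + 2 * s))

theorem fracKernel_nonneg {s : ℝ} (hs : 0 < s) (h : Eucl n) : 0 ≤ fracKernel n s h := by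
  have := fracConst_nonneg (n := n) hs
  unfold fracKernel
  positivity

theorem measurable_fracKernel (s : ℝ) : Measurable (fracKernel n s) := by
  unfold fracKernel
  fun_prop

theorem radial_integrand_near {s y : ℝ} (hn : 1 ≤ n) (hy : 0 < y) :
    y ^ (n - 1) * (y ^ 2 * y ^ (-((n : ℝ) + 2 * s))) = y ^ (1 - 2 * s) := by
  rw [← Real.rpow_natCast, ← Real.rpow_natCast, ← Real.rpow_add hy, ← Real.rpow_add hy]
  congr 1
  push_cast [Nat.cast_sub hn]
  ring

theorem radial_integrand_far {s y : ℝ} (hn : 1 ≤ n) (hy : 0 < y) :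
    y ^ (n - 1) * y ^ (-((n : ℝ) + 2 * s)) = y ^ (-1 - 2 * s) := by
  rw [← Real.rpow_natCast, ← Real.rpow_add hy]
  congr 1
  push_cast [Nat.cast_sub hn]
  ring

theorem nontrivial_eucl (hn : 1 ≤ n) : Nontrivial (Eucl n) :=
  Module.nontrivial_of_finrank_pos (R := ℝ) (by rw [finrank_euclideanSpace_fin]; omega)

theorem integrableOn_ball_sq_mul_fracKernel (hn : 1 ≤ n) {s δ : ℝ} (hs : s < 1)
    (hδ : 0 < δ) :
    IntegrableOn (fun h : Eucl n => ‖h‖ ^ 2 * fracKernel n s h) (Metric.ball 0 δ) := by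
  have := nontrivial_eucl hn
  have h1 : IntegrableOn (fun h : Eucl n => ‖h‖ ^ 2 * ‖h‖ ^ (-((n : ℝ) + 2 * s)))
      (Metric.ball 0 δ) := by
    rw [integrableOn_fun_norm_addHaar volume (f := fun y => y ^ 2 * y ^ (-((n : ℝ) + 2 * s)))]
    simp only [finrank_euclideanSpace_fin, smul_eq_mul]
    refine (((intervalIntegral.integrableOn_Ioo_rpow_iff hδ (s := 1 - 2 * s)).2
      (by linarith))).congr_fun (fun y hy => (radial_integrand_near hn hy.1).symm)
      measurableSet_Ioo
  refine IntegrableOn.congr_fun (h1.const_mul (fracConst n s / 2)) (fun h _ => ?_) measurableSet_ball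
  simp only [fracKernel]
  ring

theorem integral_ball_sq_mul_fracKernel (hn : 1 ≤ n) {s δ : ℝ} (hs : s < 1) (hδ : 0 < δ) :
    ∫ h in Metric.ball (0 : Eucl n) δ, ‖h‖ ^ 2 * fracKernel n s h =
      fracConst n s / (1 - s) * (n * unitBallVolume n / 4) * δ ^ (2 - 2 * s) := by
  have := nontrivial_eucl hn
  have e : (Metric.ball (0 : Eucl n) δ).indicator (fun h => ‖h‖ ^ 2 * fracKernel n s h) =
      fun h : Eucl n => (Set.Iio δ).indicator
        (fun y => fracConst n s / 2 * (y ^ 2 * y ^ (-((n : ℝ) + 2 * s)))) ‖h‖ := by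
    ext h
    by_cases hh : ‖h‖ < δ
    · rw [Set.indicator_of_mem (by simpa using hh), Set.indicator_of_mem (by exact hh), fracKernel]
      ring
    · rw [Set.indicator_of_notMem (by simpa using hh), Set.indicator_of_notMem (by exact hh)]
  rw [← integral_indicator measurableSet_ball, e, integral_fun_norm_addHaar]
  simp only [finrank_euclideanSpace_fin, smul_eq_mul, nsmul_eq_mul]
  have e2 : ∫ y in Set.Ioi (0 : ℝ), y ^ (n - 1) * (Set.Iio δ).indicator
        (fun y => fracConst n s / 2 * (y ^ 2 * y ^ (-((n : ℝ) + 2 * s)))) y =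
      fracConst n s / 2 * (δ ^ (2 - 2 * s) / (2 - 2 * s)) := by
    have : ∀ y ∈ Set.Ioi (0 : ℝ), y ^ (n - 1) * (Set.Iio δ).indicator
        (fun y => fracConst n s / 2 * (y ^ 2 * y ^ (-((n : ℝ) + 2 * s)))) y =
        (Set.Iio δ).indicator (fun y => fracConst n s / 2 * y ^ (1 - 2 * s)) y := by
      intro y hy
      by_cases hh : y < δ
      · rw [Set.indicator_of_mem (by exact hh), Set.indicator_of_mem (by exact hh),
          ← radial_integrand_near hn hy]
        ring
      · rw [Set.indicator_of_notMem (by exact hh), Set.indicator_of_notMem (by exact hh), mul_zero]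
    rw [setIntegral_congr_fun measurableSet_Ioi this, setIntegral_indicator measurableSet_Iio,
      Set.Ioi_inter_Iio, integral_const_mul, ← integral_Ioc_eq_integral_Ioo,
      ← intervalIntegral.integral_of_le hδ.le, integral_rpow (Or.inl (by linarith)),
      Real.zero_rpow (by linarith)]
    ring_nf
  rw [e2]
  have : 1 - s ≠ 0 := by linarith
  have : 2 - 2 * s ≠ 0 := by linarith
  field_simp
  ring

theorem integrableOn_compl_ball_fracKernel (hn : 1 ≤ n) {s δ : ℝ} (hs : 0 < s) (hδ : 0 < δ) :
    IntegrableOn (fracKernel n s) (Metric.ball (0 : Eucl n) δ)ᶜ ∧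
    ∫ h in (Metric.ball (0 : Eucl n) δ)ᶜ, fracKernel n s h =
      fracConst n s * (n * unitBallVolume n / 4) * (δ ^ (-2 * s) / s) := by
  have := nontrivial_eucl hn
  set f : ℝ → ℝ := (Set.Ici δ).indicator
        (fun y => fracConst n s / 2 * y ^ (-((n : ℝ) + 2 * s))) with hf
  have e : (Metric.ball (0 : Eucl n) δ)ᶜ.indicator (fracKernel n s) = fun h : Eucl n => f ‖h‖ := by
    ext h
    by_cases hh : ‖h‖ < δ
    · rw [Set.indicator_of_notMem (by simpa using hh), hf,
        Set.indicator_of_notMem (by simpa using hh)]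
    · rw [Set.indicator_of_mem (by simpa using hh), hf, Set.indicator_of_mem (by simpa using hh),
        fracKernel]
  have e1 : ∀ y ∈ Set.Ioi (0 : ℝ), y ^ (n - 1) * f y =
      (Set.Ici δ).indicator (fun y => fracConst n s / 2 * y ^ (-1 - 2 * s)) y := by
    intro y hy
    by_cases hh : y < δ
    · rw [hf, Set.indicator_of_notMem (by simpa using hh),
        Set.indicator_of_notMem (by simpa using hh), mul_zero]
    · rw [hf, Set.indicator_of_mem (by simpa using hh), Set.indicator_of_mem (by simpa using hh),
        ← radial_integrand_far hn hy]
      ring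
  have hsub : Set.Ioi (0 : ℝ) ∩ Set.Ici δ = Set.Ici δ :=
    Set.inter_eq_right.2 fun y hy => lt_of_lt_of_le hδ hy
  have hlt : -1 - 2 * s < -1 := by linarith
  constructor
  · rw [← integrable_indicator_iff measurableSet_ball.compl, e, integrable_fun_norm_addHaar]
    simp only [finrank_euclideanSpace_fin, smul_eq_mul]
    refine IntegrableOn.congr_fun ?_ (fun y hy => (e1 y hy).symm) measurableSet_Ioi
    rw [IntegrableOn, integrable_indicator_iff measurableSet_Ici, IntegrableOn,
      Measure.restrict_restrict measurableSet_Ici, Set.inter_comm, hsub, ← IntegrableOn,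
      integrableOn_Ici_iff_integrableOn_Ioi]
    exact (integrableOn_Ioi_rpow_of_lt hlt hδ).const_mul _
  · rw [← integral_indicator measurableSet_ball.compl, e, integral_fun_norm_addHaar]
    simp only [finrank_euclideanSpace_fin, smul_eq_mul, nsmul_eq_mul]
    rw [setIntegral_congr_fun measurableSet_Ioi e1, setIntegral_indicator measurableSet_Ici, hsub,
      integral_Ici_eq_integral_Ioi, integral_const_mul, integral_Ioi_rpow_of_lt hlt hδ]
    rw [show -1 - 2 * s + 1 = -2 * s by ring]
    field_simp
    ring

/-- The radial integral contributes `1/(1-s)`, which cancels the zero of the constant; the power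
`δ^(2-2s)` tends to `1`, so the limit does not see `δ`. -/
theorem tendsto_integral_ball_sq_mul_fracKernel (hn : 1 ≤ n) {δ : ℝ} (hδ : 0 < δ) :
    Tendsto (fun s => ∫ h in Metric.ball (0 : Eucl n) δ, ‖h‖ ^ 2 * fracKernel n s h)
      (𝓝[<] 1) (𝓝 n) := by
  have hv : unitBallVolume n ≠ 0 := by
    have hpi : 0 < Real.pi ^ ((n : ℝ) / 2) := Real.rpow_pos_of_pos Real.pi_pos _
    have hG : 0 < Real.Gamma ((n : ℝ) / 2 + 1) := Real.Gamma_pos_of_pos (by positivity)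
    rw [unitBallVolume_eq hn]
    positivity
  have c : ContinuousAt (fun s : ℝ => δ ^ (2 - 2 * s)) 1 :=
    ContinuousAt.comp (f := fun s : ℝ => 2 - 2 * s) (Real.continuousAt_const_rpow hδ.ne')
      (by fun_prop)
  have t := ((tendsto_fracConst_div hn).mul_const (n * unitBallVolume n / 4)).mul
    (c.tendsto.mono_left (nhdsWithin_le_nhds (s := Set.Iio 1)))
  have e : 4 / unitBallVolume n * (n * unitBallVolume n / 4) * δ ^ (2 - 2 * (1 : ℝ)) = n := by
    norm_num
    field_simp
  rw [e] at t
  refine t.congr' ?_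
  filter_upwards [self_mem_nhdsWithin] with s hs
  rw [integral_ball_sq_mul_fracKernel hn hs hδ]

/-- Away from the origin nothing compensates the factor `1 - s` in the constant. -/
theorem tendsto_integral_compl_ball_fracKernel (hn : 1 ≤ n) {δ : ℝ} (hδ : 0 < δ) :
    Tendsto (fun s => ∫ h in (Metric.ball (0 : Eucl n) δ)ᶜ, fracKernel n s h)
      (𝓝[<] 1) (𝓝 0) := by
  have c : ContinuousAt (fun s : ℝ => δ ^ (-2 * s) / s) 1 :=
    (ContinuousAt.comp (f := fun s : ℝ => -2 * s) (Real.continuousAt_const_rpow hδ.ne')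
      (by fun_prop)).div continuousAt_id one_ne_zero
  have c1 : ContinuousAt (fun s : ℝ => 1 - s) 1 := by fun_prop
  have t0 := (tendsto_fracConst_div hn).mul
    (c1.tendsto.mono_left (nhdsWithin_le_nhds (s := Set.Iio 1)))
  have t := (t0.mul_const (n * unitBallVolume n / 4)).mul
    (c.tendsto.mono_left (nhdsWithin_le_nhds (s := Set.Iio 1)))
  simp only [sub_self, mul_zero, zero_mul] at t
  refine t.congr' ?_
  filter_upwards [Ioo_mem_nhdsLT (zero_lt_one' ℝ)] with s hs
  have : 1 - s ≠ 0 := by linarith [hs.2]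
  rw [(integrableOn_compl_ball_fracKernel hn hs.1 hδ).2, div_mul_cancel₀ _ this]

theorem integral_ball_comp_isometry (e : Eucl n ≃ₗᵢ[ℝ] Eucl n) (f : Eucl n → ℝ) (δ : ℝ) :
    ∫ h in Metric.ball (0 : Eucl n) δ, f (e h) = ∫ h in Metric.ball (0 : Eucl n) δ, f h := by
  have := e.measurePreserving.setIntegral_preimage_emb
    e.toHomeomorph.measurableEmbedding f (Metric.ball 0 δ)
  rw [← this]
  congr 2
  ext x
  simp

theorem fracKernel_isometry (e : Eucl n ≃ₗᵢ[ℝ] Eucl n) (s : ℝ) (h : Eucl n) :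
    fracKernel n s (e h) = fracKernel n s h := by simp [fracKernel]

theorem integrableOn_ball_coord_mul_fracKernel (hn : 1 ≤ n) {s δ : ℝ} (hs0 : 0 < s) (hs : s < 1)
    (hδ : 0 < δ) (i j : Fin n) :
    IntegrableOn (fun h : Eucl n => h i * h j * fracKernel n s h) (Metric.ball 0 δ) := by
  refine Integrable.mono' (integrableOn_ball_sq_mul_fracKernel hn hs hδ) ?_
    (Eventually.of_forall fun h => ?_)
  · have := measurable_fracKernel (n := n) s
    exact Measurable.aestronglyMeasurable (by fun_prop)
  · rw [norm_mul, norm_mul, Real.norm_of_nonneg (fracKernel_nonneg hs0 h), sq]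
    gcongr
    · exact fracKernel_nonneg hs0 h
    · exact PiLp.norm_apply_le h i
    · exact PiLp.norm_apply_le h j

theorem integral_ball_offdiag (s δ : ℝ) {i j : Fin n} (hij : i ≠ j) :
    ∫ h in Metric.ball (0 : Eucl n) δ, h i * h j * fracKernel n s h = 0 := by
  -- Reflection in the `i`-th coordinate: the integrand is odd under it.
  let e : Eucl n ≃ₗᵢ[ℝ] Eucl n := LinearIsometryEquiv.piLpCongrRight 2
    (fun k => if k = i then LinearIsometryEquiv.neg ℝ else LinearIsometryEquiv.refl ℝ ℝ)
  have h1 := integral_ball_comp_isometry e (fun h => h i * h j * fracKernel n s h) δ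
  simp only [fracKernel_isometry] at h1
  have hi : ∀ h : Eucl n, e h i = - h i := fun h => by simp [e]
  have hj : ∀ h : Eucl n, e h j = h j := fun h => by simp [e, hij.symm]
  simp only [hi, hj, neg_mul, integral_neg] at h1
  linarith

theorem integral_ball_diag (hn : 1 ≤ n) {s δ : ℝ} (hs0 : 0 < s) (hs : s < 1) (hδ : 0 < δ)
    (i : Fin n) :
    ∫ h in Metric.ball (0 : Eucl n) δ, h i * h i * fracKernel n s h =
      (∫ h in Metric.ball (0 : Eucl n) δ, ‖h‖ ^ 2 * fracKernel n s h) / n := by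
  have hsym : ∀ j, ∫ h in Metric.ball (0 : Eucl n) δ, h j * h j * fracKernel n s h =
      ∫ h in Metric.ball (0 : Eucl n) δ, h i * h i * fracKernel n s h := by
    intro j
    -- Swapping coordinates makes all diagonal moments equal; they add up to the moment of `‖h‖²`.
    let e : Eucl n ≃ₗᵢ[ℝ] Eucl n := LinearIsometryEquiv.piLpCongrLeft 2 ℝ ℝ (Equiv.swap i j)
    have h1 := integral_ball_comp_isometry e (fun h => h i * h i * fracKernel n s h) δ
    simp only [fracKernel_isometry] at h1
    rw [← h1]
    have hi : ∀ h : Eucl n, e h i = h j := fun h => by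
      simp [e, LinearIsometryEquiv.piLpCongrLeft_apply, Equiv.piCongrLeft']
    simp only [hi]
  have hsum : ∫ h in Metric.ball (0 : Eucl n) δ, ‖h‖ ^ 2 * fracKernel n s h =
      ∑ j, ∫ h in Metric.ball (0 : Eucl n) δ, h j * h j * fracKernel n s h := by
    rw [← integral_finsetSum _ fun j _ => integrableOn_ball_coord_mul_fracKernel hn hs0 hs hδ j j]
    congr 1 with h
    rw [EuclideanSpace.norm_sq_eq, Finset.sum_mul]
    simp [sq]
  have : (n : ℝ) ≠ 0 := by positivity
  rw [hsum]
  simp only [hsym]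
  simp
  field_simp

theorem integral_ball_quadratic (hn : 1 ≤ n) {s δ : ℝ} (hs0 : 0 < s) (hs : s < 1) (hδ : 0 < δ)
    (Q : Fin n → Fin n → ℝ) :
    IntegrableOn (fun h : Eucl n => fracKernel n s h * ∑ i, ∑ j, Q i j * (h i * h j))
      (Metric.ball 0 δ) ∧
    ∫ h in Metric.ball (0 : Eucl n) δ, fracKernel n s h * ∑ i, ∑ j, Q i j * (h i * h j) =
      (∑ i, Q i i) * ((∫ h in Metric.ball (0 : Eucl n) δ, ‖h‖ ^ 2 * fracKernel n s h) / n) := by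
  have e : (fun h : Eucl n => fracKernel n s h * ∑ i, ∑ j, Q i j * (h i * h j)) =
      fun h => ∑ i, ∑ j, Q i j * (h i * h j * fracKernel n s h) := by
    ext h
    simp only [Finset.mul_sum]
    exact Finset.sum_congr rfl fun i _ => Finset.sum_congr rfl fun j _ => by ring
  have hI := fun i j => (integrableOn_ball_coord_mul_fracKernel hn hs0 hs hδ i j).const_mul (Q i j)
  rw [e]
  refine ⟨integrable_finsetSum _ fun i _ => integrable_finsetSum _ fun j _ => hI i j, ?_⟩
  rw [integral_finsetSum _ fun i _ => integrable_finsetSum _ fun j _ => hI i j, Finset.sum_mul]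
  refine Finset.sum_congr rfl fun i _ => ?_
  rw [integral_finsetSum _ fun j _ => hI i j, Finset.sum_eq_single i]
  · rw [integral_const_mul, integral_ball_diag hn hs0 hs hδ]
  · intro j _ hj
    rw [integral_const_mul, integral_ball_offdiag s δ hj.symm, mul_zero]
  · simp

end Kernel

/-! ### Concentration of the kernel at the origin -/

section Concentration

variable {n : ℕ}

theorem integrable_fracKernel_mul (hn : 1 ≤ n) {s A : ℝ} (hs0 : 0 < s) (hs : s < 1)
    {g : Eucl n → ℝ} (hg : AEStronglyMeasurable g volume) (hA : ∀ h, |g h| ≤ A)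
    (hA2 : ∀ h, |g h| ≤ A * ‖h‖ ^ 2) :
    Integrable (fun h => fracKernel n s h * g h) volume := by
  have hm : AEStronglyMeasurable (fun h => fracKernel n s h * g h) volume :=
    (measurable_fracKernel s).aestronglyMeasurable.mul hg
  rw [← integrableOn_univ, ← Set.union_compl_self (Metric.ball (0 : Eucl n) 1)]
  refine IntegrableOn.union ?_ ?_
  · refine Integrable.mono' ((integrableOn_ball_sq_mul_fracKernel hn hs one_pos).const_mul A)
      hm.restrict (Eventually.of_forall fun h => ?_)
    rw [norm_mul, Real.norm_of_nonneg (fracKernel_nonneg hs0 h), Real.norm_eq_abs]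
    calc _ ≤ fracKernel n s h * (A * ‖h‖ ^ 2) :=
          mul_le_mul_of_nonneg_left (hA2 h) (fracKernel_nonneg hs0 h)
      _ = _ := by ring
  · refine Integrable.mono' ((integrableOn_compl_ball_fracKernel hn hs0 one_pos).1.const_mul A)
      hm.restrict (Eventually.of_forall fun h => ?_)
    rw [norm_mul, Real.norm_of_nonneg (fracKernel_nonneg hs0 h), Real.norm_eq_abs, mul_comm]
    exact mul_le_mul_of_nonneg_right (hA h) (fracKernel_nonneg hs0 h)

/-- As `s → 1`, the fractional kernel concentrates at the origin, where it extracts the trace of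
the second order part of `g`. -/
theorem tendsto_integral_fracKernel_mul (hn : 1 ≤ n) {A : ℝ} {g : Eucl n → ℝ}
    (hg : AEStronglyMeasurable g volume) (hA : ∀ h, |g h| ≤ A)
    (hA2 : ∀ h, |g h| ≤ A * ‖h‖ ^ 2) (Q : Fin n → Fin n → ℝ)
    (hQ : ∀ ε > 0, ∃ δ > 0, ∀ h ∈ Metric.ball (0 : Eucl n) δ,
      |g h - ∑ i, ∑ j, Q i j * (h i * h j)| ≤ ε * ‖h‖ ^ 2) :
    Tendsto (fun s => ∫ h, fracKernel n s h * g h) (𝓝[<] 1) (𝓝 (∑ i, Q i i)) := by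
  rw [Metric.tendsto_nhds]
  intro ε hε
  have hn0 : (0 : ℝ) < n := by exact_mod_cast hn
  -- The second moment on the ball tends to `n`, so this tolerance costs `ε / 2` in the limit.
  obtain ⟨δ, hδ, hQδ⟩ := hQ (ε / (2 * n)) (by positivity)
  set q : Eucl n → ℝ := fun h => ∑ i, ∑ j, Q i j * (h i * h j) with hq
  set T := ∑ i, Q i i with hT
  set m : ℝ → ℝ := fun s => ∫ h in Metric.ball (0 : Eucl n) δ, ‖h‖ ^ 2 * fracKernel n s h with hm
  set τ : ℝ → ℝ := fun s => ∫ h in (Metric.ball (0 : Eucl n) δ)ᶜ, fracKernel n s h with hτ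
  have tm : Tendsto m (𝓝[<] 1) (𝓝 n) := tendsto_integral_ball_sq_mul_fracKernel hn hδ
  have tτ : Tendsto τ (𝓝[<] 1) (𝓝 0) := tendsto_integral_compl_ball_fracKernel hn hδ
  have tall : Tendsto (fun s => ε / (2 * n) * m s + |T * (m s / n) - T| + A * τ s) (𝓝[<] 1)
      (𝓝 (ε / (2 * n) * n + |T * (n / n) - T| + A * 0)) :=
    ((tm.const_mul _).add (((tm.div_const _).const_mul _).sub_const _).abs).add (tτ.const_mul _)
  have e : ε / (2 * n) * n + |T * (n / n) - T| + A * 0 = ε / 2 := by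
    rw [div_self hn0.ne']
    simp
    field_simp
  rw [e] at tall
  filter_upwards [tall.eventually_lt_const (half_lt_self hε), Ioo_mem_nhdsLT (zero_lt_one' ℝ)]
    with s hs hs01
  refine lt_of_le_of_lt ?_ hs
  have hI := integrable_fracKernel_mul hn hs01.1 hs01.2 hg hA hA2
  obtain ⟨hqI, hqE⟩ := integral_ball_quadratic hn hs01.1 hs01.2 hδ Q
  have hK := fun h => fracKernel_nonneg (n := n) hs01.1 h
  -- Taylor error on the ball, exact quadratic part, and tail.
  have d1 : ∫ h, fracKernel n s h * g h =
      (∫ h in Metric.ball (0 : Eucl n) δ, (fracKernel n s h * g h - fracKernel n s h * q h)) +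
      T * (m s / n) + ∫ h in (Metric.ball (0 : Eucl n) δ)ᶜ, fracKernel n s h * g h := by
    rw [integral_sub hI.integrableOn hqI, hqE, ← integral_add_compl measurableSet_ball hI]
    ring
  have b1 : |∫ h in Metric.ball (0 : Eucl n) δ,
      (fracKernel n s h * g h - fracKernel n s h * q h)| ≤ ε / (2 * n) * m s := by
    rw [hm, ← integral_const_mul, ← Real.norm_eq_abs]
    refine norm_integral_le_of_norm_le
      ((integrableOn_ball_sq_mul_fracKernel hn hs01.2 hδ).const_mul _)
      ((ae_restrict_mem measurableSet_ball).mono fun h hh => ?_)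
    rw [← mul_sub, norm_mul, Real.norm_of_nonneg (hK h), Real.norm_eq_abs]
    calc _ ≤ fracKernel n s h * (ε / (2 * n) * ‖h‖ ^ 2) :=
          mul_le_mul_of_nonneg_left (hQδ h hh) (hK h)
      _ = _ := by ring
  have b2 : |∫ h in (Metric.ball (0 : Eucl n) δ)ᶜ, fracKernel n s h * g h| ≤ A * τ s := by
    rw [hτ, ← integral_const_mul, ← Real.norm_eq_abs]
    refine norm_integral_le_of_norm_le
      ((integrableOn_compl_ball_fracKernel hn hs01.1 hδ).1.const_mul A)
      (Eventually.of_forall fun h => ?_)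
    rw [norm_mul, Real.norm_of_nonneg (hK h), Real.norm_eq_abs, mul_comm]
    exact mul_le_mul_of_nonneg_right (hA h) (hK h)
  rw [Real.dist_eq, d1]
  have := abs_add_three (∫ h in Metric.ball (0 : Eucl n) δ,
      (fracKernel n s h * g h - fracKernel n s h * q h)) (T * (m s / n) - T)
      (∫ h in (Metric.ball (0 : Eucl n) δ)ᶜ, fracKernel n s h * g h)
  refine le_trans (le_of_eq ?_) (this.trans (by gcongr))
  congr 1
  ring

end Concentration

/-! ### From the bilinear form to the kernel integral -/

section BilinearForm

variable {n : ℕ}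

theorem quasiMeasurePreserving_add :
    Measure.QuasiMeasurePreserving (fun p : Eucl n × Eucl n => p.1 + p.2)
      (volume.prod volume) volume :=
  Measure.quasiMeasurePreserving_snd.comp
    (measurePreserving_prod_add (volume : Measure (Eucl n)) volume).quasiMeasurePreserving

theorem aestronglyMeasurable_incrementProduct {a u v : Eucl n → ℝ} (ha : Measurable a)
    (hu : AEStronglyMeasurable u volume) (hv : AEStronglyMeasurable v volume) :
    AEStronglyMeasurable (fun p : Eucl n × Eucl n => incrementProduct a u v p.1 p.2)
      (volume.prod volume) := by
  have hd : ∀ {w : Eucl n → ℝ}, AEStronglyMeasurable w volume → AEStronglyMeasurable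
      (fun p : Eucl n × Eucl n => w (p.2 + p.1) - w p.2) (volume.prod volume) := fun hw => by
    simp only [add_comm]
    exact (hw.comp_quasiMeasurePreserving quasiMeasurePreserving_add).sub hw.comp_snd
  have hm : Measurable fun p : Eucl n × Eucl n => a p.2 * a (p.2 + p.1) := by fun_prop
  exact hm.aestronglyMeasurable.mul ((hd hu).mul (hd hv))

theorem integral_norm_le_toReal {f : Eucl n → ℝ} {B : ℝ≥0∞} (hB : B ≠ ⊤)
    (h : eLpNorm f 1 volume ≤ B) : ∫ x, ‖f x‖ ≤ B.toReal := by
  by_cases hf : Integrable (fun x => ‖f x‖) volume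
  · have e := integral_norm_eq_lintegral_enorm hf.1
    simp only [norm_norm, enorm_norm] at e
    rw [e, ← eLpNorm_one_eq_lintegral_enorm]
    exact ENNReal.toReal_mono hB h
  · rw [integral_undef hf]
    exact ENNReal.toReal_nonneg

/-- The uniform bound uses only `u, v ∈ L²` and controls large `h`; the quadratic one uses the
gradients and beats the singularity of the kernel at `0`. -/
theorem exists_bound_incrementProduct {a u v : Eucl n → ℝ} {G H : Eucl n → Eucl n} {M : ℝ≥0}
    (hM : ∀ x, |a x| ≤ M)
    (hu : MemLp u 2 volume) (hv : MemLp v 2 volume)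
    (hG : MemLp G 2 volume) (hH : MemLp H 2 volume)
    (hwu : HasWeakGradient u G) (hwv : HasWeakGradient v H) :
    ∃ A : ℝ≥0∞, A ≠ ⊤ ∧ ∀ h, eLpNorm (incrementProduct a u v h) 1 volume ≤ A ∧
      eLpNorm (incrementProduct a u v h) 1 volume ≤ A * ‖h‖ₑ ^ 2 := by
  set A1 : ℝ≥0∞ := (M ^ 2 : ℝ≥0) * (2 * eLpNorm u 2 volume) * (2 * eLpNorm v 2 volume)
  set A2 : ℝ≥0∞ := (M ^ 2 : ℝ≥0) * (3 * eLpNorm G 2 volume) * (3 * eLpNorm H 2 volume)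
  have f1 : A1 ≠ ⊤ := by
    have := hu.2.ne
    have := hv.2.ne
    finiteness
  have f2 : A2 ≠ ⊤ := by
    have := hG.2.ne
    have := hH.2.ne
    finiteness
  refine ⟨A1 + A2, ENNReal.add_ne_top.2 ⟨f1, f2⟩, fun h => ⟨?_, ?_⟩⟩
  · refine ((eLpNorm_incrementProduct_le hM hu hv h).trans ?_).trans le_self_add
    simp only [A1]
    gcongr
    · exact eLpNorm_translate_sub_le_two_mul hu h
    · exact eLpNorm_translate_sub_le_two_mul hv h
  · calc _ ≤ (M ^ 2 : ℝ≥0) * (‖h‖ₑ * (3 * eLpNorm G 2 volume)) *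
          (‖h‖ₑ * (3 * eLpNorm H 2 volume)) := by
          refine (eLpNorm_incrementProduct_le hM hu hv h).trans ?_
          gcongr
          · exact hwu.eLpNorm_translate_sub_le hu hG h
          · exact hwv.eLpNorm_translate_sub_le hv hH h
      _ = A2 * ‖h‖ₑ ^ 2 := by ring
      _ ≤ _ := by
          gcongr
          exact le_add_self

theorem exists_integral_bound_incrementProduct {a u v : Eucl n → ℝ} {G H : Eucl n → Eucl n}
    {M : ℝ≥0} (hM : ∀ x, |a x| ≤ M)
    (hu : MemLp u 2 volume) (hv : MemLp v 2 volume)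
    (hG : MemLp G 2 volume) (hH : MemLp H 2 volume)
    (hwu : HasWeakGradient u G) (hwv : HasWeakGradient v H) :
    ∃ A : ℝ, ∀ h, ∫ x, ‖incrementProduct a u v h x‖ ≤ A ∧
      ∫ x, ‖incrementProduct a u v h x‖ ≤ A * ‖h‖ ^ 2 := by
  obtain ⟨A, hA, hb⟩ := exists_bound_incrementProduct hM hu hv hG hH hwu hwv
  refine ⟨A.toReal, fun h => ⟨integral_norm_le_toReal hA (hb h).1, ?_⟩⟩
  refine (integral_norm_le_toReal (by finiteness) (hb h).2).trans_eq ?_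
  simp

theorem integrable_incrementProduct {a u v : Eucl n → ℝ} {M : ℝ≥0} (ha : Measurable a)
    (hM : ∀ x, |a x| ≤ M) (hu : MemLp u 2 volume) (hv : MemLp v 2 volume) (h : Eucl n) :
    Integrable (incrementProduct a u v h) volume := by
  have mdu := (memLp_translate hu h).sub hu
  have mdv := (memLp_translate hv h).sub hv
  have h1 := memLp_bounded_mul ha hM (memLp_bounded_mul (ha.comp (measurable_add_const h))
    (fun x => hM (x + h)) (memLp_one_iff_integrable.2 (mdu.integrable_mul mdv)))
  refine (memLp_one_iff_integrable.1 h1).congr (Eventually.of_forall fun x => ?_)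
  simp only [incrementProduct, Function.comp, Pi.mul_apply, Pi.sub_apply]
  ring

/-- Tonelli: the `L¹` norm in `x` satisfies both bounds of `integrable_fracKernel_mul`. -/
theorem integrable_fracKernel_mul_incrementProduct (hn : 1 ≤ n) {a u v : Eucl n → ℝ}
    {G H : Eucl n → Eucl n} {M : ℝ≥0} (ha : Measurable a) (hM : ∀ x, |a x| ≤ M)
    (hu : MemLp u 2 volume) (hv : MemLp v 2 volume)
    (hG : MemLp G 2 volume) (hH : MemLp H 2 volume)
    (hwu : HasWeakGradient u G) (hwv : HasWeakGradient v H) {s : ℝ} (hs0 : 0 < s) (hs : s < 1) :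
    Integrable (fun p : Eucl n × Eucl n => fracKernel n s p.1 * incrementProduct a u v p.1 p.2)
      (volume.prod volume) := by
  obtain ⟨A, hA⟩ := exists_integral_bound_incrementProduct hM hu hv hG hH hwu hwv
  have hF := aestronglyMeasurable_incrementProduct ha hu.1 hv.1
  have hK : AEStronglyMeasurable (fun p : Eucl n × Eucl n => fracKernel n s p.1)
      (volume.prod volume) :=
    ((measurable_fracKernel s).comp measurable_fst).aestronglyMeasurable
  refine (integrable_prod_iff (hK.mul hF)).2 ⟨?_, ?_⟩
  · exact Eventually.of_forall fun h =>
      (integrable_incrementProduct ha hM hu hv h).const_mul (fracKernel n s h)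
  · have e : (fun h => ∫ x, ‖fracKernel n s h * incrementProduct a u v h x‖) =
        fun h => fracKernel n s h * ∫ x, ‖incrementProduct a u v h x‖ := by
      ext h
      rw [← integral_const_mul]
      simp only [norm_mul, Real.norm_of_nonneg (fracKernel_nonneg hs0 h)]
    refine Integrable.congr ?_ (Eventually.of_forall fun h => (congrFun e h).symm)
    have hnn : ∀ h, 0 ≤ ∫ x, ‖incrementProduct a u v h x‖ := fun h =>
      integral_nonneg fun x => norm_nonneg _
    refine integrable_fracKernel_mul hn hs0 hs hF.norm.integral_prod_right' (A := A)
      (fun h => ?_) fun h => ?_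
    · rw [abs_of_nonneg (hnn h)]; exact (hA h).1
    · rw [abs_of_nonneg (hnn h)]; exact (hA h).2

theorem memLp_coord {G : Eucl n → Eucl n} (hG : MemLp G 2 volume) (i : Fin n) :
    MemLp (fun x => G x i) 2 volume :=
  hG.of_le ((EuclideanSpace.proj (𝕜 := ℝ) i).continuous.comp_aestronglyMeasurable hG.1)
    (Eventually.of_forall fun x => PiLp.norm_apply_le (G x) i)

theorem integrable_sq_mul_coord {a : Eucl n → ℝ} {G H : Eucl n → Eucl n} {M : ℝ≥0}
    (ha : Measurable a) (hM : ∀ x, |a x| ≤ M) (hG : MemLp G 2 volume) (hH : MemLp H 2 volume)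
    (i j : Fin n) : Integrable (fun x => a x ^ 2 * (G x i * H x j)) volume := by
  have h1 := memLp_bounded_mul ha hM (memLp_bounded_mul ha hM
    (memLp_one_iff_integrable.2 ((memLp_coord hG i).integrable_mul (memLp_coord hH j))))
  refine (memLp_one_iff_integrable.1 h1).congr (Eventually.of_forall fun x => ?_)
  simp only [Pi.mul_apply]
  ring

theorem real_inner_eq_sum (x y : Eucl n) : (inner ℝ x y : ℝ) = ∑ i, x i * y i := by
  rw [PiLp.inner_apply]
  simp [mul_comm]

theorem integrable_quadratic_density {a : Eucl n → ℝ} {G H : Eucl n → Eucl n} {M : ℝ≥0}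
    (ha : Measurable a) (hM : ∀ x, |a x| ≤ M) (hG : MemLp G 2 volume) (hH : MemLp H 2 volume)
    (h : Eucl n) :
    Integrable (fun x => a x ^ 2 * (inner ℝ (G x) h * inner ℝ (H x) h)) volume ∧
    ∫ x, a x ^ 2 * (inner ℝ (G x) h * inner ℝ (H x) h) =
      ∑ i, ∑ j, (∫ x, a x ^ 2 * (G x i * H x j)) * (h i * h j) := by
  have e : (fun x => a x ^ 2 * (inner ℝ (G x) h * inner ℝ (H x) h : ℝ)) =
      fun x => ∑ i, ∑ j, (a x ^ 2 * (G x i * H x j)) * (h i * h j) := by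
    ext x
    rw [real_inner_eq_sum, real_inner_eq_sum, Finset.sum_mul_sum, Finset.mul_sum]
    refine Finset.sum_congr rfl fun i _ => ?_
    rw [Finset.mul_sum]
    exact Finset.sum_congr rfl fun j _ => by ring
  have hI := fun i j => (integrable_sq_mul_coord ha hM hG hH i j).mul_const (h i * h j)
  rw [e]
  refine ⟨integrable_finsetSum _ fun i _ => integrable_finsetSum _ fun j _ => hI i j, ?_⟩
  rw [integral_finsetSum _ fun i _ => integrable_finsetSum _ fun j _ => hI i j]
  refine Finset.sum_congr rfl fun i _ => ?_
  rw [integral_finsetSum _ fun j _ => hI i j]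
  simp only [integral_mul_const]

theorem integrable_sq_mul_inner {a : Eucl n → ℝ} {G H : Eucl n → Eucl n} {M : ℝ≥0}
    (ha : Measurable a) (hM : ∀ x, |a x| ≤ M) (hG : MemLp G 2 volume) (hH : MemLp H 2 volume) :
    Integrable (fun x => a x ^ 2 * inner ℝ (G x) (H x)) volume ∧
    ∫ x, a x ^ 2 * inner ℝ (G x) (H x) = ∑ i, ∫ x, a x ^ 2 * (G x i * H x i) := by
  have hI := fun i => integrable_sq_mul_coord ha hM hG hH i i
  simp only [real_inner_eq_sum, Finset.mul_sum]
  exact ⟨integrable_finsetSum _ fun i _ => hI i, integral_finsetSum _ fun i _ => hI i⟩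

theorem tendsto_integral_fracKernel_incrementProduct (hn : 1 ≤ n) {a u v : Eucl n → ℝ}
    {G H : Eucl n → Eucl n} {M : ℝ≥0} (ha : Measurable a) (hM : ∀ x, |a x| ≤ M)
    (hu : MemLp u 2 volume) (hv : MemLp v 2 volume)
    (hG : MemLp G 2 volume) (hH : MemLp H 2 volume)
    (hwu : HasWeakGradient u G) (hwv : HasWeakGradient v H) :
    Tendsto (fun s => ∫ h, fracKernel n s h * ∫ x, incrementProduct a u v h x) (𝓝[<] 1)
      (𝓝 (∫ x, a x ^ 2 * inner ℝ (G x) (H x))) := by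
  obtain ⟨A, hA⟩ := exists_integral_bound_incrementProduct hM hu hv hG hH hwu hwv
  obtain ⟨η, hη, hb⟩ := exists_modulus_incrementProduct ha hM hu hv hG hH hwu hwv
  have hF := aestronglyMeasurable_incrementProduct ha hu.1 hv.1
  rw [(integrable_sq_mul_inner ha hM hG hH).2]
  refine tendsto_integral_fracKernel_mul hn (A := A) hF.integral_prod_right'
    (fun h => (norm_integral_le_integral_norm _).trans (hA h).1)
    (fun h => (norm_integral_le_integral_norm _).trans (hA h).2)
    (fun i j => ∫ x, a x ^ 2 * (G x i * H x j)) fun ε hε => ?_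
  obtain ⟨δ, hδ, hd⟩ := Metric.eventually_nhds_iff_ball.1
    ((ENNReal.tendsto_nhds_zero.1 hη) (ENNReal.ofReal ε) (by simpa using hε))
  refine ⟨δ, hδ, fun h hh => ?_⟩
  obtain ⟨hqI, hqE⟩ := integrable_quadratic_density ha hM hG hH h
  rw [← hqE, ← integral_sub (integrable_incrementProduct ha hM hu hv h) hqI]
  refine (norm_integral_le_integral_norm (fun x => incrementProduct a u v h x -
    a x ^ 2 * (inner ℝ (G x) h * inner ℝ (H x) h))).trans ?_
  refine (integral_norm_le_toReal (B := ‖h‖ₑ ^ 2 * ENNReal.ofReal ε) (by finiteness)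
    ((hb h).trans (by gcongr; exact hd h hh))).trans_eq ?_
  simp [ENNReal.toReal_ofReal hε.le, mul_comm]

theorem bilinIntegrand_add_right {s : ℝ} (hs : 0 < s) (γ u v : Eucl n → ℝ) (x h : Eucl n) :
    bilinIntegrand s γ u v x (x + h) =
      fracKernel n s h * incrementProduct (fun x => √(γ x)) u v h x := by
  by_cases hh : h = 0
  · simp [bilinIntegrand, fracGradient, incrementProduct, hh]
  have hp : 0 < ‖h‖ := norm_pos_iff.2 hh
  have hC := fracConst_nonneg (n := n) hs
  -- Both gradients carry the vector `h`, whence `‖h‖²` over the squared denominator.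
  have e : ‖h‖ ^ (-((n : ℝ) + 2 * s)) = ‖h‖ ^ 2 / (‖h‖ ^ ((n : ℝ) / 2 + s + 1)) ^ 2 := by
    rw [← Real.rpow_natCast _ 2, ← Real.rpow_natCast _ 2, ← Real.rpow_mul hp.le,
      ← Real.rpow_sub hp]
    congr 1
    push_cast
    ring
  have hsq : (√(fracConst n s) / √2) ^ 2 = fracConst n s / 2 := by
    rw [div_pow, Real.sq_sqrt hC, Real.sq_sqrt (by norm_num)]
  simp only [bilinIntegrand, fracGradient, interaction, incrementProduct, fracKernel,
    add_sub_cancel_left, smul_apply, ContinuousLinearMap.id_apply,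
    real_inner_smul_left, real_inner_smul_right, real_inner_self_eq_norm_sq]
  rw [e, ← hsq]
  ring

theorem integrable_bilinIntegrand (hn : 1 ≤ n) {γ a u v : Eucl n → ℝ}
    {G H : Eucl n → Eucl n} {M : ℝ≥0} (ha : Measurable a) (hM : ∀ x, |a x| ≤ M)
    (haγ : ∀ᵐ x, √(γ x) = a x)
    (hu : MemLp u 2 volume) (hv : MemLp v 2 volume)
    (hG : MemLp G 2 volume) (hH : MemLp H 2 volume)
    (hwu : HasWeakGradient u G) (hwv : HasWeakGradient v H) {s : ℝ} (hs0 : 0 < s) (hs : s < 1) :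
    Integrable (fun p : Eucl n × Eucl n => bilinIntegrand s γ u v p.1 p.2)
      (volume.prod volume) ∧
    bilin s γ u v = ∫ h, fracKernel n s h * ∫ x, incrementProduct a u v h x := by
  have hW := integrable_fracKernel_mul_incrementProduct hn ha hM hu hv hG hH hwu hwv hs0 hs
  have hae : (fun p : Eucl n × Eucl n => bilinIntegrand s γ u v p.1 (p.1 + p.2)) =ᵐ[
      volume.prod volume] fun p => fracKernel n s p.2 * incrementProduct a u v p.2 p.1 := by
    filter_upwards [Measure.quasiMeasurePreserving_fst.ae haγ, quasiMeasurePreserving_add.ae haγ]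
      with p h1 h2
    rw [bilinIntegrand_add_right hs0, incrementProduct, incrementProduct, h1, h2]
  have hB : Integrable (fun p : Eucl n × Eucl n => bilinIntegrand s γ u v p.1 (p.1 + p.2))
      (volume.prod volume) := hW.swap.congr hae.symm
  constructor
  -- The shear `(x, h) ↦ (x, x + h)` carries integrability back to the variables `(x, y)`.
  · exact ((measurePreserving_prod_add (volume : Measure (Eucl n)) volume).integrable_comp_emb
      (MeasurableEquiv.shearAddRight (Eucl n)).measurableEmbedding).1 hB
  · calc bilin s γ u v = ∫ x, ∫ h, bilinIntegrand s γ u v x (x + h) := by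
          unfold bilin
          congr 1 with x
          exact (integral_add_left_eq_self (fun y => bilinIntegrand s γ u v x y) x).symm
      _ = ∫ p : Eucl n × Eucl n, fracKernel n s p.2 * incrementProduct a u v p.2 p.1
            ∂(volume.prod volume) := by
          rw [← integral_prod _ hB, integral_congr_ae hae]
      _ = ∫ h, ∫ x, fracKernel n s h * incrementProduct a u v h x := by
          exact integral_prod_symm _ hW.swap
      _ = _ := by simp only [integral_const_mul]

theorem MemH1.memLp_of_hasWeakGradient {u : Eucl n → ℝ} {G : Eucl n → Eucl n} (hu : MemH1 u)
    (hw : HasWeakGradient u G) : MemLp G 2 volume := by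
  obtain ⟨_, G', hG', hw'⟩ := hu
  exact hG'.ae_eq (hw'.ae_eq hw)

end BilinearForm

end FracCond
end

theorem lemma4p3 (n : ℕ) (hn : 1 ≤ n)
    (γ : FracCond.Eucl n → ℝ) (hγ : Measurable γ)
    (γlow γup : ℝ) (hlow : 0 < γlow) (hbound : ∀ᵐ x, γlow ≤ γ x ∧ γ x ≤ γup)
    (u v : FracCond.Eucl n → ℝ) (hu : FracCond.MemH1 u) (hv : FracCond.MemH1 v)
    (gradu gradv : FracCond.Eucl n → FracCond.Eucl n)
    (hgradu : FracCond.HasWeakGradient u gradu) (hgradv : FracCond.HasWeakGradient v gradv) :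
    (∀ s : ℝ, 0 < s → s < 1 →
      Integrable (fun p : FracCond.Eucl n × FracCond.Eucl n =>
        FracCond.bilinIntegrand s γ u v p.1 p.2) (volume.prod volume)) ∧
    Integrable (fun x => γ x * inner ℝ (gradu x) (gradv x)) volume ∧
    Tendsto (fun s : ℝ => FracCond.bilin s γ u v) (𝓝[<] 1)
      (𝓝 (∫ x, γ x * inner ℝ (gradu x) (gradv x))) := by
  let M : NNReal := ⟨√γup, Real.sqrt_nonneg _⟩
  -- The bounds on `γ` hold only almost everywhere; truncation gives a weight bounded at every point
  -- and almost everywhere equal to `√γ`.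
  let a : FracCond.Eucl n → ℝ := fun x => min (√(γ x)) (√γup)
  have ha : Measurable a := hγ.sqrt.min measurable_const
  have hM : ∀ x, |a x| ≤ M := fun x => by
    rw [abs_of_nonneg (le_min (Real.sqrt_nonneg _) (Real.sqrt_nonneg _))]
    exact min_le_right _ _
  have haγ : ∀ᵐ x, √(γ x) = a x :=
    hbound.mono fun x hx => (min_eq_left (Real.sqrt_le_sqrt hx.2)).symm
  have hG := hu.memLp_of_hasWeakGradient hgradu
  have hH := hv.memLp_of_hasWeakGradient hgradv
  have hae : (fun x => a x ^ 2 * inner ℝ (gradu x) (gradv x)) =ᵐ[volume]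
      fun x => γ x * inner ℝ (gradu x) (gradv x) := by
    filter_upwards [hbound, haγ] with x hx hax
    rw [← hax, Real.sq_sqrt (hlow.le.trans hx.1)]
  have hB := fun (s : ℝ) (h0 : 0 < s) (h1 : s < 1) => FracCond.integrable_bilinIntegrand hn ha hM
    haγ hu.1 hv.1 hG hH hgradu hgradv h0 h1
  refine ⟨fun s h0 h1 => (hB s h0 h1).1,
    (FracCond.integrable_sq_mul_inner ha hM hG hH).1.congr hae, ?_⟩
  rw [← integral_congr_ae hae]
  refine (FracCond.tendsto_integral_fracKernel_incrementProduct hn ha hM hu.1 hv.1 hG hH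
    hgradu hgradv).congr' ?_
  filter_upwards [Ioo_mem_nhdsLT (zero_lt_one' ℝ)] with s hs
  exact (hB s hs.1 hs.2).2.symm
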